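/- Let $\Bbbk$ be a field and let $2 \le a \le b$ be integers. Let $S_{a,b}=\Bbbk[x_1,\dots,x_a,x_1',\dots,x_b',y_1',\dots,y_a',y_1,\dots,y_b]$, and let $\mathcal{R}(K_{a,b})\subset S_{a,b}$ be the binomial edge ring of the complete bipartite graph $K_{a,b}$, that is, the $\Bbbk$-subalgebra generated by the binomials $x_iy_j-x_j'y_i'$ for $1\le i\le a$, $1\le j\le b$. Let $<$ be the graded lexicographic order on $S_{a,b}$ with $$x_1>\cdots>x_a>x_1'>\cdots>x_b'>y_1'>\cdots>y_a'>y_1>\cdots>y_b .$$ The initial algebra $\mathrm{in}_<(A)$ of a subalgebra $A\subset S_{a,b}$ is the $\Bbbk$-subalgebra generated by the initial monomials $\mathrm{in}_<(g)$ of all nonzero $g\in A$. For a finite poset $\Pi$, the Hibi ring $\Bbbk[\Pi]$ is the $\Bbbk$-subalgebra of the polynomial ring $\Bbbk[t,\,x_p : p\in\Pi]$ generated by the monomials $t\prod_{p\in I}x_p$, where $I$ runs over all poset ideals (down-closed subsets, including $\emptyset$) of $\Pi$. Let $\Pi_{a,b}$ be the poset with the $2a+2b-5$ elements $e_1,\dots,e_{a-1}$,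 $e_2',\dots,e_{a-1}'$, $f_1',\dots,f_{b-1}'$, $f_2,\dots,f_b$ whose order is the reflexive-transitive closure of the relations $$e_{a-1}<\cdots<e_2<e_1,\qquad f_2<f_3<\cdots<f_b,\qquad f_1'<e_{a-1}'<\cdots<e_3'<e_2',\qquad f_1'<f_2'<\cdots<f_{b-1}',$$ $$e_i<e_{i+1}'\ (1\le i\le a-2),\qquad e_{a-1}<f_1',\qquad f_{j+1}<f_j'\ (1\le j\le b-1).$$ Then the initial algebra $\mathrm{in}_<(\mathcal{R}(K_{a,b}))$ is isomorphic, as a $\Bbbk$-algebra, to the Hibi ring $\Bbbk[\Pi_{a,b}]$. -/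

import Mathlib

open MvPolynomial

/-! ### Binomial edge rings -/

/-- The `2|V|` variables `x_v`, `y_v` (`v ∈ V`). The order on this index type lists all `x_v`
before all `y_v`, and otherwise follows the order of `V`. -/
abbrev EdgeVar (V : Type*) := V ⊕ₗ V

/-- The variable `x_v`. -/
noncomputable def xVar (k : Type*) [Field k] {V : Type*} (v : V) : MvPolynomial (EdgeVar V) k :=
  X (Sum.inlₗ v)

/-- The variable `y_v`. -/
noncomputable def yVar (k : Type*) [Field k] {V : Type*} (v : V) : MvPolynomial (EdgeVar V) k :=
  X (Sum.inrₗ v)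

/-- The binomial edge ring of `G`: the `k`-subalgebra of `k[x_v, y_v : v ∈ V]` generated by the
binomials `x_i y_j - x_j y_i` for the edges `{i, j}` of `G`. (An edge contributes its binomial and
the negative of it, which does not change the subalgebra.) -/
noncomputable def binomialEdgeRing (k : Type*) [Field k] {V : Type*} (G : SimpleGraph V) :
    Subalgebra k (MvPolynomial (EdgeVar V) k) :=
  Algebra.adjoin k
    {p | ∃ i j : V, G.Adj i j ∧ p = xVar k i * yVar k j - xVar k j * yVar k i}

/-- The complete bipartite graph `K_{a,b}` (Mathlib's), its vertices being ordered by
`1 < ⋯ < a` (first part) `< 1 < ⋯ < b` (second part). -/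
def orderedCompleteBipartiteGraph (a b : ℕ) : SimpleGraph (Fin a ⊕ₗ Fin b) :=
  (completeBipartiteGraph (Fin a) (Fin b)).comap ofLex

/-! ### Initial algebras -/

/-- The initial algebra of a subalgebra `A` of a polynomial ring with respect to the monomial
order `m`: the subalgebra generated by the initial monomials of the nonzero elements of `A`. -/
noncomputable def initialAlgebra {k : Type*} [Field k] {σ : Type*} (m : MonomialOrder σ)
    (A : Subalgebra k (MvPolynomial σ k)) : Subalgebra k (MvPolynomial σ k) :=
  Algebra.adjoin k {p | ∃ g ∈ A, g ≠ 0 ∧ p = monomial (m.degree g) (1 : k)}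

/-! ### Hibi rings -/

open scoped Classical in
/-- The Hibi ring of a finite poset `P`: the `k`-subalgebra generated by the monomials
`t * ∏ p ∈ I, x_p`, where `I` runs through the poset ideals (lower sets, including `∅`) of `P`.
The variable `x_p` is `X (some p)` and the additional variable `t` is `X none`. -/
noncomputable def hibiRing (k : Type*) [Field k] (P : Type*) [PartialOrder P] [Fintype P] :
    Subalgebra k (MvPolynomial (Option P) k) :=
  Algebra.adjoin k
    (Set.range fun I : LowerSet P ↦
      X none * ∏ p ∈ Finset.univ.filter (fun p : P ↦ p ∈ I), X (some p))

/-! ### The poset `Π_{a,b}` -/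

/-- The elements of `Π_{a,b}`: `e_1, …, e_{a-1}`, `e'_2, …, e'_{a-1}`, `f'_1, …, f'_{b-1}`
and `f_2, …, f_b`. -/
inductive BipartitePoset (a b : ℕ) : Type
  | e (i : Set.Ico 1 a)
  | e' (i : Set.Ico 2 a)
  | f' (j : Set.Ico 1 b)
  | f (j : Set.Icc 2 b)

namespace BipartitePoset

variable {a b : ℕ}

/-- The edges of the Hasse diagram of `Π_{a,b}`, the lower end first. -/
inductive Edge : BipartitePoset a b → BipartitePoset a b → Prop
  /-- the chain `e_{a-1} < ⋯ < e_2 < e_1` -/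
  | e_e (i k : Set.Ico 1 a) : (i : ℕ) = k + 1 → Edge (e i) (e k)
  /-- the chain `f_2 < f_3 < ⋯ < f_b` -/
  | f_f (j l : Set.Icc 2 b) : (l : ℕ) = j + 1 → Edge (f j) (f l)
  /-- the chain `e'_{a-1} < ⋯ < e'_3 < e'_2` -/
  | e'_e' (i k : Set.Ico 2 a) : (i : ℕ) = k + 1 → Edge (e' i) (e' k)
  /-- the chain `f'_1 < f'_2 < ⋯ < f'_{b-1}` -/
  | f'_f' (j l : Set.Ico 1 b) : (l : ℕ) = j + 1 → Edge (f' j) (f' l)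
  /-- `f'_1 < e'_{a-1}` -/
  | f'_e' (j : Set.Ico 1 b) (i : Set.Ico 2 a) :
      (j : ℕ) = 1 → (i : ℕ) + 1 = a → Edge (f' j) (e' i)
  /-- `e_i < e'_{i+1}` for `1 ≤ i ≤ a - 2` -/
  | e_e' (i : Set.Ico 1 a) (k : Set.Ico 2 a) : (k : ℕ) = i + 1 → Edge (e i) (e' k)
  /-- `e_{a-1} < f'_1` -/
  | e_f' (i : Set.Ico 1 a) (j : Set.Ico 1 b) :
      (i : ℕ) + 1 = a → (j : ℕ) = 1 → Edge (e i) (f' j)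
  /-- `f_{j+1} < f'_j` for `1 ≤ j ≤ b - 1` -/
  | f_f' (j : Set.Icc 2 b) (l : Set.Ico 1 b) : (j : ℕ) = l + 1 → Edge (f j) (f' l)

/-- The height of an element of `Π_{a,b}` in its Hasse diagram. -/
def height : BipartitePoset a b → ℕ
  | e i => a - 1 - i
  | e' i => a + 1 - i
  | f' j => j
  | f j => j - 2

theorem Edge.height_lt {p q : BipartitePoset a b} (h : Edge p q) : p.height < q.height := by
  cases h with
  | e_e i k h => have : (i : ℕ) < a := i.2.2; simp only [height]; omega
  | f_f j l h => have : 2 ≤ (j : ℕ) := j.2.1; simp only [height]; omega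
  | e'_e' i k h => have : (i : ℕ) < a := i.2.2; simp only [height]; omega
  | f'_f' j l h => simp only [height]; omega
  | f'_e' j i h h1 => simp only [height]; omega
  | e_e' i k h => have : (k : ℕ) < a := k.2.2; simp only [height]; omega
  | e_f' i j h h1 => simp only [height]; omega
  | f_f' j l h => have : 1 ≤ (l : ℕ) := l.2.1; simp only [height]; omega

theorem eq_or_height_lt {p q : BipartitePoset a b} (h : Relation.ReflTransGen Edge p q) :
    p = q ∨ p.height < q.height := by
  induction h with
  | refl => exact Or.inl rfl
  | tail _ hbc ih =>
    rcases ih with rfl | ih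
    · exact Or.inr hbc.height_lt
    · exact Or.inr (ih.trans hbc.height_lt)

/-- `p ≤ q` if there is an ascending path from `p` to `q` in the Hasse diagram. -/
instance : PartialOrder (BipartitePoset a b) where
  le := Relation.ReflTransGen Edge
  le_refl _ := Relation.ReflTransGen.refl
  le_trans _ _ _ := Relation.ReflTransGen.trans
  le_antisymm p q hpq hqp := by
    rcases eq_or_height_lt hpq with h | h
    · exact h
    · rcases eq_or_height_lt hqp with h' | h'
      · exact h'.symm
      · exact absurd h h'.asymm

/-- `Π_{a,b}` as a disjoint union of four intervals. -/
def equivSum (a b : ℕ) :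
    (Set.Ico 1 a ⊕ Set.Ico 2 a) ⊕ (Set.Ico 1 b ⊕ Set.Icc 2 b) ≃ BipartitePoset a b where
  toFun
    | .inl (.inl i) => e i
    | .inl (.inr i) => e' i
    | .inr (.inl j) => f' j
    | .inr (.inr j) => f j
  invFun
    | e i => .inl (.inl i)
    | e' i => .inl (.inr i)
    | f' j => .inr (.inl j)
    | f j => .inr (.inr j)
  left_inv := by rintro ((i | i) | (j | j)) <;> rfl
  right_inv := by rintro (i | i | j | j) <;> rfl

instance : Fintype (BipartitePoset a b) := Fintype.ofEquiv _ (equivSum a b)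

end BipartitePoset

/-!
The binomials `x_i y_j - x'_j y'_i` are the entries of the product of an `a × 2` matrix with rows
`(x_i, y'_i)` and a `2 × b` matrix with columns `(y_j, -x'_j)`, so the binomial edge ring of
`K_{a,b}` is the coordinate ring of the `a × b` matrices of rank at most `2`. The `2`-minors of the
product matrix factor as `(x_i y'_l - x_l y'_i) (x'_j y_n - x'_n y_j)`. The generators, with leading
monomials `x_i y_j`, and these minors, with leading monomials `x_i y'_l x'_j y_n` for `i < l` and
`j < n`, form a SAGBI basis, and its members correspond to the poset ideals of `Π_{a,b}`
(`sagbiIdeal`, `sagbiLowerSet_surjective`).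

The SAGBI property is a matter of straightening (`hasStraightening_sagbi`): the product of the
members attached to two poset ideals equals the product of the members attached to their
intersection and their union, up to products of members with smaller leading monomials. This comes
from the factorization of the `2`-minors, the three-term relations between a vector and the minors
of a two-row matrix, and the Plücker relation. Splitting off the intersection of all ideals again
and again brings every product of members to a normal form that is determined by its leading
monomial. Hence two products with the same leading monomial differ by products with smaller ones
(`HasStraightening.prod_sub_prod_mem`), and no leading monomials arise besides those of products
(`HasStraightening.exists_degree_eq`).

It remains to compare two monomial algebras. The substitution `hibiExp` takes the leading monomials
of the SAGBI basis to the generators of the Hibi ring. It is injective on the exponents that occur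
(`injOn_hibiExp`): these have as many `x` as `y`, as many `x'` as `y'`, and involve neither `y'_1`
nor `x'_b`, so that they can be recovered from the partial sums which `hibiExp` records.
-/

/-! ### Initial algebras of algebras with straightening relations -/

section Straightening

variable {k : Type*} [Field k] {σ : Type*} (m : MonomialOrder σ) {L : Type*}
  (g : L → MvPolynomial σ k)

/-- The exponent of the leading monomial of the product of the family `g` over a multiset, provided
that all members of `g` are nonzero. -/
noncomputable def multisetDegree (s : Multiset L) : σ →₀ ℕ :=
  (s.map fun I ↦ m.degree (g I)).sum

/-- The span of those products of members of `g` whose leading monomials satisfy `r`. -/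
noncomputable def productSpan (r : m.syn → Prop) : Submodule k (MvPolynomial σ k) :=
  Submodule.span k {f | ∃ s : Multiset L, r (m.toSyn (multisetDegree m g s)) ∧ f = (s.map g).prod}

@[simp]
theorem multisetDegree_zero : multisetDegree m g 0 = 0 := by simp [multisetDegree]

@[simp]
theorem multisetDegree_cons (I : L) (s : Multiset L) :
    multisetDegree m g (I ::ₘ s) = m.degree (g I) + multisetDegree m g s := by
  simp [multisetDegree]

theorem multisetDegree_add (s t : Multiset L) :
    multisetDegree m g (s + t) = multisetDegree m g s + multisetDegree m g t := by
  simp [multisetDegree]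

variable {m g}

theorem prod_mem_productSpan {r : m.syn → Prop} {s : Multiset L}
    (hs : r (m.toSyn (multisetDegree m g s))) : (s.map g).prod ∈ productSpan m g r :=
  Submodule.subset_span ⟨s, hs, rfl⟩

theorem productSpan_mono {r r' : m.syn → Prop} (h : ∀ x, r x → r' x) :
    productSpan m g r ≤ productSpan m g r' :=
  Submodule.span_mono fun _ ⟨s, hs, e⟩ ↦ ⟨s, h _ hs, e⟩

theorem mul_prod_mem_productSpan_lt {μ : m.syn} {f : MvPolynomial σ k}
    (hf : f ∈ productSpan m g (· < μ)) (t : Multiset L) :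
    f * (t.map g).prod ∈ productSpan m g (· < μ + m.toSyn (multisetDegree m g t)) := by
  induction hf using Submodule.span_induction with
  | mem x hx =>
    obtain ⟨s, hs, rfl⟩ := hx
    refine Submodule.subset_span ⟨s + t, ?_, by simp⟩
    rw [multisetDegree_add, map_add]
    exact add_lt_add_left hs _
  | zero => simp
  | add x y _ _ hx hy => rw [add_mul]; exact add_mem hx hy
  | smul c x _ hx => rw [smul_mul_assoc]; exact Submodule.smul_mem _ _ hx

theorem mul_mem_productSpan_lt {μ : m.syn} {f : MvPolynomial σ k}
    (hf : f ∈ productSpan m g (· < μ)) (I : L) :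
    g I * f ∈ productSpan m g (· < m.toSyn (m.degree (g I)) + μ) := by
  have := mul_prod_mem_productSpan_lt hf {I}
  simpa [multisetDegree, mul_comm, add_comm] using this

theorem monic_multiset_prod (hg : ∀ I, m.Monic (g I)) (s : Multiset L) :
    m.Monic (s.map g).prod ∧ m.degree (s.map g).prod = multisetDegree m g s := by
  induction s using Multiset.induction_on with
  | empty => simp [MonomialOrder.monic_one]
  | cons I s ih =>
    rw [Multiset.map_cons, Multiset.prod_cons, multisetDegree_cons]
    refine ⟨(hg I).mul ih.1, ?_⟩
    rw [m.degree_mul (hg I).ne_zero ih.1.ne_zero, ih.2]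

variable {P : Type*} {S : L → Set P}

variable (m g S) in
/-- There is a straightening relation for `g p * g q`: this product differs from the one over the
meet and the join of `p` and `q` by a combination of products with smaller leading monomials. The
lattice structure of the index set enters through the map `S` to sets alone. -/
def Straightens (p q : L) : Prop :=
  ∃ u v, S u = S p ∩ S q ∧ S v = S p ∪ S q ∧
    m.degree (g p) + m.degree (g q) = m.degree (g u) + m.degree (g v) ∧
    g p * g q - g u * g v ∈
      productSpan m g (· < m.toSyn (m.degree (g p) + m.degree (g q)))

variable (m g S) in
/-- The family `g` has straightening relations for all pairs of indices. -/
def HasStraightening : Prop :=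
  ∀ p q, Straightens m g S p q

theorem Straightens.symm {p q : L} (h : Straightens m g S p q) : Straightens m g S q p := by
  obtain ⟨u, v, hu, hv, hd, hp⟩ := h
  rw [add_comm, mul_comm] at hp
  exact ⟨u, v, by rw [hu, Set.inter_comm], by rw [hv, Set.union_comm], by rw [← hd, add_comm], hp⟩

theorem straightens_of_subset {p q : L} (h : S p ⊆ S q) : Straightens m g S p q :=
  ⟨p, q, (Set.inter_eq_left.2 h).symm, (Set.union_eq_right.2 h).symm, rfl, by simp⟩

/-- Modulo products with smaller leading monomials, the meet of all factors can be split off. -/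
theorem HasStraightening.exists_inf (h : HasStraightening m g S) (s : Multiset L) (I : L) :
    ∃ J t, S J = {p | ∀ K ∈ I ::ₘ s, p ∈ S K} ∧ t.card = s.card ∧
      multisetDegree m g (I ::ₘ s) = multisetDegree m g (J ::ₘ t) ∧
      ((I ::ₘ s).map g).prod - ((J ::ₘ t).map g).prod ∈
        productSpan m g (· < m.toSyn (multisetDegree m g (I ::ₘ s))) := by
  induction s using Multiset.induction_on generalizing I with
  | empty => exact ⟨I, 0, by simp, rfl, rfl, by simp⟩
  | cons I₀ s ih =>
    obtain ⟨J, t, hJ, ht, hd, hp⟩ := ih I₀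
    obtain ⟨u, v, hu, hv, hd', hp'⟩ := h I J
    refine ⟨u, v ::ₘ t, ?_, by simp [ht], ?_, ?_⟩
    · rw [hu, hJ]
      ext p
      simp only [Set.mem_inter_iff, Set.mem_ofPred_eq, Multiset.mem_cons, forall_eq_or_imp]
    · rw [multisetDegree_cons, hd, multisetDegree_cons, multisetDegree_cons, multisetDegree_cons,
        ← add_assoc, hd', add_assoc]
    · have h1 := mul_mem_productSpan_lt hp I
      have h2 := mul_prod_mem_productSpan_lt hp' t
      rw [← map_add, ← multisetDegree_cons] at h1
      rw [← map_add, add_assoc, ← multisetDegree_cons, ← hd, ← multisetDegree_cons] at h2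
      convert add_mem h1 h2 using 1
      simp only [Multiset.map_cons, Multiset.prod_cons]
      ring

/-- Two products with the same leading monomial agree modulo products with smaller leading
monomials, since the meet of the factors can be read off from the leading monomial. -/
theorem HasStraightening.prod_sub_prod_mem (h : HasStraightening m g S)
    (hS : Function.Injective S)
    (hdeg : ∀ s t, multisetDegree m g s = multisetDegree m g t →
      s.card = t.card ∧ {p | ∀ K ∈ s, p ∈ S K} = {p | ∀ K ∈ t, p ∈ S K})
    (s s' : Multiset L) (hs : multisetDegree m g s = multisetDegree m g s') :
    (s.map g).prod - (s'.map g).prod ∈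
      productSpan m g (· < m.toSyn (multisetDegree m g s)) := by
  induction hn : s.card generalizing s s' with
  | zero =>
    have h1 := (hdeg _ _ hs).1
    rw [hn] at h1
    rw [Multiset.card_eq_zero.1 hn, Multiset.card_eq_zero.1 h1.symm]
    simp
  | succ n ih =>
    have h1 := (hdeg _ _ hs).1
    obtain ⟨I, hI⟩ := Multiset.card_pos_iff_exists_mem.1 (by omega : 0 < s.card)
    obtain ⟨s, rfl⟩ := Multiset.exists_cons_of_mem hI
    obtain ⟨I', hI'⟩ := Multiset.card_pos_iff_exists_mem.1 (by omega : 0 < s'.card)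
    obtain ⟨s', rfl⟩ := Multiset.exists_cons_of_mem hI'
    obtain ⟨J, t, hJ, ht, hd, hp⟩ := h.exists_inf s I
    obtain ⟨J', t', hJ', ht', hd', hp'⟩ := h.exists_inf s' I'
    have hJJ : J = J' := hS (by rw [hJ, hJ', (hdeg _ _ hs).2])
    subst hJJ
    have htt : multisetDegree m g t = multisetDegree m g t' := by
      have := hd.symm.trans (hs.trans hd')
      simpa using this
    have h2 := mul_mem_productSpan_lt (ih t t' htt (by simp at hn; omega)) J
    rw [← map_add, ← multisetDegree_cons, ← hd] at h2
    rw [← hs] at hp'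
    convert add_mem (sub_mem hp hp') h2 using 1
    simp only [Multiset.map_cons, Multiset.prod_cons]
    ring

theorem eq_zero_or_degree_lt_of_mem_productSpan (hg : ∀ I, m.Monic (g I)) {μ : m.syn}
    {f : MvPolynomial σ k} (hf : f ∈ productSpan m g (· < μ)) :
    f = 0 ∨ m.toSyn (m.degree f) < μ := by
  induction hf using Submodule.span_induction with
  | mem x hx =>
    obtain ⟨s, hs, rfl⟩ := hx
    rw [(monic_multiset_prod hg s).2]
    exact Or.inr hs
  | zero => exact Or.inl rfl
  | add x y _ _ hx hy =>
    rcases hx with rfl | hx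
    · simpa using hy
    rcases hy with rfl | hy
    · simpa using Or.inr hx
    exact Or.inr (m.degree_add_le.trans_lt (max_lt hx hy))
  | smul c x _ hx =>
    rcases hx with rfl | hx
    · simp
    exact Or.inr (m.degree_smul_le.trans_lt hx)

theorem exists_le_of_mem_productSpan_lt {μ : m.syn}
    {f : MvPolynomial σ k} (hf : f ∈ productSpan m g (· < μ)) :
    f = 0 ∨ ∃ ν < μ, f ∈ productSpan m g (· ≤ ν) := by
  induction hf using Submodule.span_induction with
  | mem x hx =>
    obtain ⟨s, hs, rfl⟩ := hx
    exact Or.inr ⟨_, hs, prod_mem_productSpan le_rfl⟩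
  | zero => exact Or.inl rfl
  | add x y _ _ hx hy =>
    rcases hx with rfl | ⟨ν, hν, hx⟩
    · simpa using hy
    rcases hy with rfl | ⟨ν', hν', hy⟩
    · simpa using Or.inr ⟨ν, hν, hx⟩
    refine Or.inr ⟨max ν ν', max_lt hν hν', add_mem ?_ ?_⟩
    · exact productSpan_mono (fun z hz ↦ hz.trans (le_max_left _ _)) hx
    · exact productSpan_mono (fun z hz ↦ hz.trans (le_max_right _ _)) hy
  | smul c x _ hx =>
    rcases hx with rfl | ⟨ν, hν, hx⟩
    · simp
    exact Or.inr ⟨ν, hν, Submodule.smul_mem _ _ hx⟩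

theorem exists_productSpan_of_mem_adjoin {f : MvPolynomial σ k}
    (hf : f ∈ Algebra.adjoin k (Set.range g)) : ∃ ν, f ∈ productSpan m g (· ≤ ν) := by
  rw [← Subalgebra.mem_toSubmodule, Algebra.adjoin_eq_span] at hf
  induction hf using Submodule.span_induction with
  | mem x hx =>
    have : ∃ s : Multiset L, x = (s.map g).prod := by
      induction hx using Submonoid.closure_induction with
      | mem x hx =>
        obtain ⟨I, rfl⟩ := hx
        exact ⟨{I}, by simp⟩
      | one => exact ⟨0, by simp⟩
      | mul x y _ _ hx hy =>
        obtain ⟨s, rfl⟩ := hx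
        obtain ⟨t, rfl⟩ := hy
        exact ⟨s + t, by simp⟩
    obtain ⟨s, rfl⟩ := this
    exact ⟨_, prod_mem_productSpan le_rfl⟩
  | zero => exact ⟨0, zero_mem _⟩
  | add x y _ _ hx hy =>
    obtain ⟨ν, hx⟩ := hx
    obtain ⟨ν', hy⟩ := hy
    refine ⟨max ν ν', add_mem ?_ ?_⟩
    · exact productSpan_mono (fun z hz ↦ hz.trans (le_max_left _ _)) hx
    · exact productSpan_mono (fun z hz ↦ hz.trans (le_max_right _ _)) hy
  | smul c x _ hx =>
    obtain ⟨ν, hx⟩ := hx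
    exact ⟨ν, Submodule.smul_mem _ _ hx⟩

/-- The members of `g` form a SAGBI basis: the leading monomial of every nonzero element of the
algebra they generate is a product of theirs. In a representation of `f` by products with the
least possible bound `ν` on their leading monomials, `ν` does not cancel. -/
theorem HasStraightening.exists_degree_eq (h : HasStraightening m g S)
    (hg : ∀ I, m.Monic (g I)) (hS : Function.Injective S)
    (hdeg : ∀ s t, multisetDegree m g s = multisetDegree m g t →
      s.card = t.card ∧ {p | ∀ K ∈ s, p ∈ S K} = {p | ∀ K ∈ t, p ∈ S K})
    {f : MvPolynomial σ k} (hf : f ∈ Algebra.adjoin k (Set.range g)) (hf0 : f ≠ 0) :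
    ∃ s, m.degree f = multisetDegree m g s := by
  obtain ⟨ν, hν, hmin⟩ := WellFounded.has_min (wellFounded_lt (α := m.syn))
    {ν | f ∈ productSpan m g (· ≤ ν)} (exists_productSpan_of_mem_adjoin hf)
  have hlt : f ∉ productSpan m g (· < ν) := fun hf' ↦ by
    rcases exists_le_of_mem_productSpan_lt hf' with h0 | ⟨ν', h1, h2⟩
    · exact hf0 h0
    · exact hmin ν' h2 h1
  obtain ⟨s₀, hs₀⟩ : ∃ s, m.toSyn (multisetDegree m g s) = ν := by
    by_contra! hne
    refine hlt (Submodule.span_mono ?_ hν)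
    rintro _ ⟨s, hs, rfl⟩
    exact ⟨s, lt_of_le_of_ne hs (hne s), rfl⟩
  have key : ∀ f' ∈ productSpan m g (· ≤ ν),
      ∃ c : k, f' - c • (s₀.map g).prod ∈ productSpan m g (· < ν) := by
    intro f' hf'
    induction hf' using Submodule.span_induction with
    | mem x hx =>
      obtain ⟨s, hs, rfl⟩ := hx
      rcases hs.lt_or_eq with hs | hs
      · exact ⟨0, by simpa using prod_mem_productSpan hs⟩
      · refine ⟨1, ?_⟩
        have := h.prod_sub_prod_mem hS hdeg s s₀ (m.toSyn.injective (hs.trans hs₀.symm))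
        rw [hs] at this
        simpa using this
    | zero => exact ⟨0, by simp⟩
    | add x y _ _ hx hy =>
      obtain ⟨c, hx⟩ := hx
      obtain ⟨d, hy⟩ := hy
      refine ⟨c + d, ?_⟩
      convert add_mem hx hy using 1
      rw [add_smul]; ring
    | smul c x _ hx =>
      obtain ⟨d, hx⟩ := hx
      refine ⟨c * d, ?_⟩
      convert Submodule.smul_mem _ c hx using 1
      rw [smul_sub, mul_smul]
  obtain ⟨c, hc⟩ := key f hν
  have hc0 : c ≠ 0 := by
    rintro rfl
    exact hlt (by simpa using hc)
  refine ⟨s₀, ?_⟩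
  have hd : m.degree (c • (s₀.map g).prod) = multisetDegree m g s₀ := by
    rw [m.degree_smul_of_isRegular (IsRegular.of_ne_zero hc0), (monic_multiset_prod hg s₀).2]
  rcases eq_zero_or_degree_lt_of_mem_productSpan hg hc with h0 | h0
  · rw [sub_eq_zero.1 h0, hd]
  · rw [← sub_add_cancel f (c • (s₀.map g).prod), m.degree_add_eq_right_of_lt, hd]
    rw [hd, hs₀]
    exact h0

theorem monomial_add_one (d e : σ →₀ ℕ) :
    monomial (d + e) (1 : k) = monomial d 1 * monomial e 1 := by
  rw [monomial_mul, one_mul]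

theorem HasStraightening.initialAlgebra_eq (h : HasStraightening m g S)
    (hg : ∀ I, m.Monic (g I)) (hS : Function.Injective S)
    (hdeg : ∀ s t, multisetDegree m g s = multisetDegree m g t →
      s.card = t.card ∧ {p | ∀ K ∈ s, p ∈ S K} = {p | ∀ K ∈ t, p ∈ S K}) :
    initialAlgebra m (Algebra.adjoin k (Set.range g)) =
      Algebra.adjoin k (Set.range fun I ↦ monomial (m.degree (g I)) (1 : k)) := by
  refine le_antisymm (Algebra.adjoin_le ?_) (Algebra.adjoin_mono ?_)
  · rintro _ ⟨f, hf, hf0, rfl⟩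
    obtain ⟨s, hs⟩ := h.exists_degree_eq hg hS hdeg hf hf0
    rw [hs, SetLike.mem_coe]
    clear hs
    induction s using Multiset.induction_on with
    | empty => simp
    | cons I s ih =>
      rw [multisetDegree_cons, monomial_add_one]
      exact mul_mem (Algebra.subset_adjoin ⟨I, rfl⟩) ih
  · rintro _ ⟨I, rfl⟩
    exact ⟨g I, Algebra.subset_adjoin ⟨I, rfl⟩, (hg I).ne_zero, rfl⟩

end Straightening

/-! ### Isomorphisms of monomial algebras -/

section Monomial

variable {k : Type*} [Field k] {σ τ : Type*}

theorem support_subset_of_mem_adjoin_monomial {M : AddSubmonoid (σ →₀ ℕ)} {L : Type*}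
    {d : L → σ →₀ ℕ} (hd : ∀ I, d I ∈ M) {f : MvPolynomial σ k}
    (hf : f ∈ Algebra.adjoin k (Set.range fun I ↦ monomial (d I) (1 : k))) :
    ∀ e ∈ f.support, e ∈ M := by
  classical
  induction hf using Algebra.adjoin_induction with
  | mem x hx =>
    obtain ⟨I, rfl⟩ := hx
    intro e he
    rw [Finset.mem_singleton.1 (support_monomial_subset he)]
    exact hd I
  | algebraMap r =>
    intro e he
    rw [algebraMap_eq, C_apply] at he
    rw [Finset.mem_singleton.1 (support_monomial_subset he)]
    exact zero_mem M
  | add x y _ _ hx hy =>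
    intro e he
    rcases Finset.mem_union.1 (support_add he) with h | h
    exacts [hx e h, hy e h]
  | mul x y _ _ hx hy =>
    intro e he
    obtain ⟨u, hu, v, hv, rfl⟩ := Finset.mem_add.1 (support_mul x y he)
    exact add_mem (hx u hu) (hy v hv)

/-- The substitution of monomials given by an additive map `w` of exponents. -/
noncomputable def monomialSubst (k : Type*) [Field k] (w : (σ →₀ ℕ) →+ (τ →₀ ℕ)) :
    MvPolynomial σ k →ₐ[k] MvPolynomial τ k :=
  aeval fun v ↦ monomial (w (Finsupp.single v 1)) 1

theorem monomialSubst_monomial (w : (σ →₀ ℕ) →+ (τ →₀ ℕ)) (d : σ →₀ ℕ) (c : k) :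
    monomialSubst k w (monomial d c) = monomial (w d) c := by
  rw [monomialSubst, aeval_monomial, algebraMap_eq]
  have : (d.prod fun v n ↦ (monomial (w (Finsupp.single v 1)) (1 : k)) ^ n) =
      monomial (w d) 1 := by
    induction d using Finsupp.induction_linear with
    | zero => simp
    | add d e hd he =>
      rw [Finsupp.prod_add_index' (by simp) (by intros; rw [pow_add]), hd, he, map_add,
        monomial_mul, one_mul]
    | single v n =>
      rw [Finsupp.prod_single_index (by simp), monomial_pow, one_pow, ← map_nsmul,
        Finsupp.smul_single, smul_eq_mul, mul_one]
  rw [this, C_mul_monomial, mul_one]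

theorem coeff_monomialSubst {M : Set (σ →₀ ℕ)} (w : (σ →₀ ℕ) →+ (τ →₀ ℕ))
    (hw : Set.InjOn w M) {f : MvPolynomial σ k} (hf : ∀ e ∈ f.support, e ∈ M) {d : σ →₀ ℕ}
    (hd : d ∈ M) : coeff (w d) (monomialSubst k w f) = coeff d f := by
  classical
  conv_lhs => rw [f.as_sum]
  rw [map_sum, coeff_sum]
  simp only [monomialSubst_monomial, coeff_monomial]
  rw [Finset.sum_eq_single d]
  · simp
  · intro e he hne
    exact if_neg fun h ↦ hne (hw (hf e he) hd h)
  · intro h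
    simpa using h

/-- Monomial algebras are isomorphic if an additive map that is injective on a submonoid containing
the exponents of the generators takes generators to generators. -/
theorem nonempty_algEquiv_adjoin_monomial {M : AddSubmonoid (σ →₀ ℕ)} {L : Type*}
    {d : L → σ →₀ ℕ} (hd : ∀ I, d I ∈ M) (w : (σ →₀ ℕ) →+ (τ →₀ ℕ)) (hw : Set.InjOn w M) :
    Nonempty (Algebra.adjoin k (Set.range fun I ↦ monomial (d I) (1 : k)) ≃ₐ[k]
      Algebra.adjoin k (Set.range fun I ↦ monomial (w (d I)) (1 : k))) := by
  set A := Algebra.adjoin k (Set.range fun I ↦ monomial (d I) (1 : k)) with hA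
  have hinj : Function.Injective ((monomialSubst k w).comp A.val) := by
    rw [injective_iff_map_eq_zero]
    rintro ⟨f, hf⟩ h0
    have hsupp := support_subset_of_mem_adjoin_monomial hd hf
    ext e
    by_cases he : e ∈ M
    · rw [← coeff_monomialSubst w hw hsupp he]
      exact congrArg (coeff (w e)) h0
    · simpa using fun h ↦ he (hsupp e (mem_support_iff.2 h))
  have hrange : ((monomialSubst k w).comp A.val).range =
      Algebra.adjoin k (Set.range fun I ↦ monomial (w (d I)) (1 : k)) := by
    rw [AlgHom.range_comp, Subalgebra.range_val, hA, AlgHom.map_adjoin, ← Set.range_comp]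
    simp only [Function.comp_def, monomialSubst_monomial]
  exact ⟨(AlgEquiv.ofInjective _ hinj).trans (Subalgebra.equivOfEq _ _ hrange)⟩

end Monomial

/-! ### A SAGBI basis of the binomial edge ring of `K_{a,b}` -/

section EdgeRing

open scoped MonomialOrder

variable {a b : ℕ}

/-- The index of the variable `x_i`. -/
abbrev xLeft (i : Fin a) : EdgeVar (Fin a ⊕ₗ Fin b) := Sum.inlₗ (Sum.inlₗ i)

/-- The index of the variable `x'_j`. -/
abbrev xRight (j : Fin b) : EdgeVar (Fin a ⊕ₗ Fin b) := Sum.inlₗ (Sum.inrₗ j)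

/-- The index of the variable `y'_i`. -/
abbrev yLeft (i : Fin a) : EdgeVar (Fin a ⊕ₗ Fin b) := Sum.inrₗ (Sum.inlₗ i)

/-- The index of the variable `y_j`. -/
abbrev yRight (j : Fin b) : EdgeVar (Fin a ⊕ₗ Fin b) := Sum.inrₗ (Sum.inrₗ j)

variable (b) in
/-- The exponent of `x_i y'_{i'}`. -/
noncomputable def rowExp (i i' : Fin a) : EdgeVar (Fin a ⊕ₗ Fin b) →₀ ℕ :=
  Finsupp.single (xLeft i) 1 + Finsupp.single (yLeft i') 1

variable (a) in
/-- The exponent of `x'_j y_{j'}`. -/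
noncomputable def colExp (j j' : Fin b) : EdgeVar (Fin a ⊕ₗ Fin b) →₀ ℕ :=
  Finsupp.single (xRight j) 1 + Finsupp.single (yRight j') 1

/-- The exponent of `x_i y_j`. -/
noncomputable def edgeExp (i : Fin a) (j : Fin b) : EdgeVar (Fin a ⊕ₗ Fin b) →₀ ℕ :=
  Finsupp.single (xLeft i) 1 + Finsupp.single (yRight j) 1

/-- The exponent of `x'_j y'_i`. -/
noncomputable def edgeExp' (i : Fin a) (j : Fin b) : EdgeVar (Fin a ⊕ₗ Fin b) →₀ ℕ :=
  Finsupp.single (xRight j) 1 + Finsupp.single (yLeft i) 1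

theorem degLex_single_add_single_lt {σ : Type*} [LinearOrder σ] [WellFoundedGT σ] {p q r s : σ}
    (hp : r < p) (hq : r < q) (hs : r < s) :
    (Finsupp.single p 1 + Finsupp.single q 1) ≺[MonomialOrder.degLex]
      (Finsupp.single r 1 + Finsupp.single s 1) := by
  rw [MonomialOrder.degLex_lt_iff, Finsupp.DegLex.lt_iff]
  refine Or.inr ⟨by simp [map_add], r, fun j hj ↦ ?_, ?_⟩
  · have h1 : p ≠ j := (hj.trans hp).ne'
    have h2 : q ≠ j := (hj.trans hq).ne'
    have h3 : r ≠ j := hj.ne'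
    have h4 : s ≠ j := (hj.trans hs).ne'
    simp [h1, h2, h3, h4]
  · simp [Finsupp.single_apply, hp.ne', hq.ne']

theorem rowExp_lt {i i' : Fin a} (h : i < i') :
    rowExp b i' i ≺[MonomialOrder.degLex] rowExp b i i' :=
  degLex_single_add_single_lt (by simpa using h) (Sum.Lex.inl_lt_inr _ _) (Sum.Lex.inl_lt_inr _ _)

theorem colExp_lt {j j' : Fin b} (h : j < j') :
    colExp a j' j ≺[MonomialOrder.degLex] colExp a j j' :=
  degLex_single_add_single_lt (by simpa using h) (Sum.Lex.inl_lt_inr _ _) (Sum.Lex.inl_lt_inr _ _)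

theorem edgeExp_lt (i : Fin a) (j : Fin b) :
    edgeExp' i j ≺[MonomialOrder.degLex] edgeExp i j :=
  degLex_single_add_single_lt (Sum.Lex.inl_lt_inl_iff.2 (Sum.Lex.inl_lt_inr _ _))
    (Sum.Lex.inl_lt_inr _ _) (Sum.Lex.inl_lt_inr _ _)

theorem toSyn_lt_of_eq_add {σ : Type*} {m : MonomialOrder σ} {d e d' e' : σ →₀ ℕ} (c : σ →₀ ℕ)
    (h : d ≺[m] e) (hd : d' = c + d) (he : e' = c + e) : d' ≺[m] e' := by
  rw [hd, he, map_add, map_add]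
  exact add_lt_add_right h _

variable (k : Type*) [Field k]

/-- The generator `x_i y_j - x'_j y'_i` of the binomial edge ring. -/
noncomputable def edgePoly (i : Fin a) (j : Fin b) : MvPolynomial (EdgeVar (Fin a ⊕ₗ Fin b)) k :=
  X (xLeft i) * X (yRight j) - X (xRight j) * X (yLeft i)

variable (b) in
/-- The `2`-minor `x_i y'_{i'} - x_{i'} y'_i`. -/
noncomputable def rowMinor (i i' : Fin a) : MvPolynomial (EdgeVar (Fin a ⊕ₗ Fin b)) k :=
  X (xLeft i) * X (yLeft i') - X (xLeft i') * X (yLeft i)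

variable (a) in
/-- The `2`-minor `x'_j y_{j'} - x'_{j'} y_j`. -/
noncomputable def colMinor (j j' : Fin b) : MvPolynomial (EdgeVar (Fin a ⊕ₗ Fin b)) k :=
  X (xRight j) * X (yRight j') - X (xRight j') * X (yRight j)

variable {k}

theorem degree_monic_of_eq_sub {σ : Type*} {m : MonomialOrder σ} {p q r s : σ}
    (h : (Finsupp.single r 1 + Finsupp.single s 1) ≺[m] (Finsupp.single p 1 + Finsupp.single q 1)) :
    m.Monic (X p * X q - X r * X s : MvPolynomial σ k) ∧
      m.degree (X p * X q - X r * X s : MvPolynomial σ k) =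
        Finsupp.single p 1 + Finsupp.single q 1 := by
  have e : ∀ u v : σ, m.degree (X u * X v : MvPolynomial σ k) =
      Finsupp.single u 1 + Finsupp.single v 1 := fun u v ↦ by
    rw [m.degree_mul (X_ne_zero _) (X_ne_zero _), m.degree_X, m.degree_X]
  rw [← e, ← e] at h
  refine ⟨?_, by rw [m.degree_sub_of_lt h, e]⟩
  rw [MonomialOrder.Monic, m.leadingCoeff_sub_of_lt h]
  exact m.monic_X.mul m.monic_X

theorem edgePoly_monic (i : Fin a) (j : Fin b) :
    MonomialOrder.degLex.Monic (edgePoly k i j) ∧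
      MonomialOrder.degLex.degree (edgePoly k i j) = edgeExp i j :=
  degree_monic_of_eq_sub (edgeExp_lt i j)

theorem rowMinor_monic {i i' : Fin a} (h : i < i') :
    MonomialOrder.degLex.Monic (rowMinor b k i i') ∧
      MonomialOrder.degLex.degree (rowMinor b k i i') = rowExp b i i' :=
  degree_monic_of_eq_sub (rowExp_lt h)

theorem colMinor_monic {j j' : Fin b} (h : j < j') :
    MonomialOrder.degLex.Monic (colMinor a k j j') ∧
      MonomialOrder.degLex.degree (colMinor a k j j') = colExp a j j' :=
  degree_monic_of_eq_sub (colExp_lt h)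

variable (a b) in
/-- The index set of the SAGBI basis: the edges, and the pairs of a `2`-subset of each part. -/
inductive SagbiIndex : Type
  | edge (i : Fin a) (j : Fin b)
  | minors (i i' : Fin a) (j j' : Fin b) (hi : i < i') (hj : j < j')

open SagbiIndex

variable (k) in
/-- The SAGBI basis: the generators of the binomial edge ring and the `2`-minors of the matrix
they form. -/
noncomputable def sagbi : SagbiIndex a b → MvPolynomial (EdgeVar (Fin a ⊕ₗ Fin b)) k
  | edge i j => edgePoly k i j
  | minors i i' j j' _ _ => rowMinor b k i i' * colMinor a k j j'

/-- The exponents of the leading monomials of the SAGBI basis. -/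
noncomputable def sagbiExp : SagbiIndex a b → EdgeVar (Fin a ⊕ₗ Fin b) →₀ ℕ
  | edge i j => edgeExp i j
  | minors i i' j j' _ _ => rowExp b i i' + colExp a j j'

theorem sagbi_monic (I : SagbiIndex a b) : MonomialOrder.degLex.Monic (sagbi k I) := by
  cases I with
  | edge i j => exact (edgePoly_monic i j).1
  | minors i i' j j' hi hj => exact (rowMinor_monic hi).1.mul (colMinor_monic hj).1

@[simp]
theorem degree_sagbi (I : SagbiIndex a b) :
    MonomialOrder.degLex.degree (sagbi k I) = sagbiExp I := by
  cases I with
  | edge i j => exact (edgePoly_monic i j).2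
  | minors i i' j j' hi hj =>
    rw [sagbi, MonomialOrder.degree_mul (rowMinor_monic hi).1.ne_zero
      (colMinor_monic hj).1.ne_zero, (rowMinor_monic hi).2, (colMinor_monic hj).2, sagbiExp]

/-- The identity exhibiting the products of minors as `2`-minors of the matrix of generators. -/
theorem edgePoly_mul_sub (i i' : Fin a) (j j' : Fin b) :
    edgePoly k i j * edgePoly k i' j' - edgePoly k i' j * edgePoly k i j' =
      rowMinor b k i i' * colMinor a k j j' := by
  simp only [edgePoly, rowMinor, colMinor]; ring

theorem binomialEdgeRing_eq_adjoin_sagbi :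
    binomialEdgeRing k (orderedCompleteBipartiteGraph a b) =
      Algebra.adjoin k (Set.range (sagbi k)) := by
  have hadj (i : Fin a) (j : Fin b) :
      (orderedCompleteBipartiteGraph a b).Adj (Sum.inlₗ i) (Sum.inrₗ j) := by
    simp [orderedCompleteBipartiteGraph]
  have hedge (i : Fin a) (j : Fin b) :
      edgePoly k i j ∈ binomialEdgeRing k (orderedCompleteBipartiteGraph a b) :=
    Algebra.subset_adjoin ⟨_, _, hadj i j, rfl⟩
  refine le_antisymm (Algebra.adjoin_le ?_) (Algebra.adjoin_le ?_)
  · rintro _ ⟨u, v, huv, rfl⟩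
    rcases u with u | u <;> rcases v with v | v
    · exact absurd (show (completeBipartiteGraph _ _).Adj (Sum.inl u) (Sum.inl v) from huv)
        (by simp)
    · exact Algebra.subset_adjoin ⟨edge u v, rfl⟩
    · have := neg_mem (Algebra.subset_adjoin (R := k) (Set.mem_range_self (f := sagbi k) (edge v u)))
      rw [sagbi, edgePoly, neg_sub] at this
      exact this
    · exact absurd (show (completeBipartiteGraph _ _).Adj (Sum.inr u) (Sum.inr v) from huv)
        (by simp)
  · rintro _ ⟨I, rfl⟩
    cases I with
    | edge i j => exact hedge i j
    | minors i i' j j' hi hj =>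
      rw [sagbi, ← edgePoly_mul_sub]
      exact sub_mem (mul_mem (hedge _ _) (hedge _ _)) (mul_mem (hedge _ _) (hedge _ _))

/-- The poset ideals of `Π_{a,b}` attached to the SAGBI basis. Vertices are counted from `0` here
and from `1` in `Π_{a,b}`. -/
def sagbiIdeal : SagbiIndex a b → BipartitePoset a b → Prop
  | edge i _, .e l => (i : ℕ) + 1 ≤ l
  | edge _ _, .e' _ => False
  | edge _ _, .f' _ => False
  | edge _ j, .f l => (l : ℕ) ≤ j + 1
  | minors i _ _ _ _ _, .e l => (i : ℕ) + 1 ≤ l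
  | minors _ i' _ _ _ _, .e' l => (i' : ℕ) + 1 ≤ l
  | minors _ _ j _ _ _, .f' l => (l : ℕ) ≤ j + 1
  | minors _ _ _ j' _ _, .f l => (l : ℕ) ≤ j' + 1

end EdgeRing

/-! ### Straightening relations in the binomial edge ring -/

section Relations

open scoped MonomialOrder
open SagbiIndex

variable {a b : ℕ} {k : Type*} [Field k]

theorem sagbi_mul_mem_productSpan {I J : SagbiIndex a b} {d : EdgeVar (Fin a ⊕ₗ Fin b) →₀ ℕ}
    (h : (sagbiExp I + sagbiExp J) ≺[MonomialOrder.degLex] d) :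
    sagbi k I * sagbi k J ∈ productSpan MonomialOrder.degLex (sagbi k)
      (· < MonomialOrder.degLex.toSyn d) := by
  have := prod_mem_productSpan (m := MonomialOrder.degLex) (g := sagbi k) (s := {I, J})
    (r := (· < MonomialOrder.degLex.toSyn d)) (by simpa [multisetDegree] using h)
  simpa using this

variable (k) in
theorem straightens_edge_edge (i l : Fin a) (j n : Fin b) :
    Straightens MonomialOrder.degLex (sagbi k) (fun I ↦ {p | sagbiIdeal I p})
      (edge i j) (edge l n) := by
  have key (i l : Fin a) (j n : Fin b) (hil : i < l) (hjn : j < n) :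
      Straightens MonomialOrder.degLex (sagbi k) (fun I ↦ {p | sagbiIdeal I p})
        (edge i j) (edge l n) := by
    refine ⟨edge l j, edge i n, ?_, ?_, ?_, ?_⟩
    · ext (p | p | p | p) <;> simp [sagbiIdeal] <;> omega
    · ext (p | p | p | p) <;> simp [sagbiIdeal] <;> omega
    · simp only [degree_sagbi, sagbiExp, edgeExp]; abel
    · have h := prod_mem_productSpan (m := MonomialOrder.degLex) (g := sagbi k)
        (s := {minors i l j n hil hjn})
        (r := (· < MonomialOrder.degLex.toSyn (sagbiExp (edge i j) + sagbiExp (edge l n)))) (by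
          simp only [multisetDegree, Multiset.map_singleton, Multiset.sum_singleton, degree_sagbi]
          refine toSyn_lt_of_eq_add (Finsupp.single (xLeft i) 1 + Finsupp.single (yRight n) 1)
            (edgeExp_lt l j) ?_ ?_ <;>
          · simp only [sagbiExp, edgeExp, edgeExp', rowExp, colExp]; abel)
      simp only [Multiset.map_singleton, Multiset.prod_singleton] at h
      simp only [degree_sagbi]
      convert h using 1
      exact edgePoly_mul_sub i l j n
  rcases lt_or_ge i l with hil | hil <;> rcases lt_or_ge j n with hjn | hjn
  · exact key i l j n hil hjn
  · refine (straightens_of_subset ?_).symm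
    rintro (p | p | p | p) <;> simp [sagbiIdeal] <;> omega
  · refine straightens_of_subset ?_
    rintro (p | p | p | p) <;> simp [sagbiIdeal] <;> omega
  · rcases hil.eq_or_lt with rfl | hil
    · refine (straightens_of_subset ?_).symm
      rintro (p | p | p | p) <;> simp [sagbiIdeal]
      omega
    rcases hjn.eq_or_lt with rfl | hjn
    · refine straightens_of_subset ?_
      rintro (p | p | p | p) <;> simp [sagbiIdeal]
      omega
    exact (key l i n j hil hjn).symm

variable (k) in
theorem straightens_edge_minors (i l l' : Fin a) (j n n' : Fin b) (hl : l < l') (hn : n < n') :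
    Straightens MonomialOrder.degLex (sagbi k) (fun I ↦ {p | sagbiIdeal I p})
      (edge i j) (minors l l' n n' hl hn) := by
  -- The three-term relations between the minors of a `2`-row matrix and a vector.
  have hrow (i l l' : Fin a) (j : Fin b) : edgePoly k i j * rowMinor b k l l' =
      edgePoly k l j * rowMinor b k i l' - edgePoly k l' j * rowMinor b k i l := by
    simp only [edgePoly, rowMinor]; ring
  have hcol (i : Fin a) (j n n' : Fin b) : edgePoly k i j * colMinor a k n n' =
      edgePoly k i n' * colMinor a k n j - edgePoly k i n * colMinor a k n' j := by
    simp only [edgePoly, colMinor]; ring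
  rcases lt_or_ge i l with hil | hil <;> rcases lt_or_ge n' j with hjn | hjn
  · refine ⟨edge l n', minors i l' n j (hil.trans hl) (hn.trans hjn), ?_, ?_, ?_, ?_⟩
    · ext (p | p | p | p) <;> simp [sagbiIdeal] <;> omega
    · ext (p | p | p | p) <;> simp [sagbiIdeal] <;> omega
    · simp only [degree_sagbi, sagbiExp, edgeExp, rowExp, colExp]; abel
    · simp only [degree_sagbi]
      have h1 := sagbi_mul_mem_productSpan (k := k) (I := edge l' j) (J := minors i l n n' hil hn)
        (d := sagbiExp (edge i j) + sagbiExp (minors l l' n n' hl hn)) (by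
          refine toSyn_lt_of_eq_add (Finsupp.single (xLeft i) 1 + Finsupp.single (yRight j) 1 +
            colExp a n n') (rowExp_lt hl) ?_ ?_ <;>
          · simp only [sagbiExp, edgeExp, rowExp, colExp]; abel)
      have h2 := sagbi_mul_mem_productSpan (k := k) (I := edge l n)
        (J := minors i l' n' j (hil.trans hl) hjn)
        (d := sagbiExp (edge i j) + sagbiExp (minors l l' n n' hl hn)) (by
          refine toSyn_lt_of_eq_add (Finsupp.single (xLeft i) 1 + Finsupp.single (yRight j) 1 +
            rowExp b l l') (colExp_lt hn) ?_ ?_ <;>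
          · simp only [sagbiExp, edgeExp, rowExp, colExp]; abel)
      convert neg_mem (add_mem h1 h2) using 1
      simp only [sagbi]
      linear_combination colMinor a k n n' * hrow i l l' j + rowMinor b k i l' * hcol l j n n'
  · refine ⟨edge l j, minors i l' n n' (hil.trans hl) hn, ?_, ?_, ?_, ?_⟩
    · ext (p | p | p | p) <;> simp [sagbiIdeal] <;> omega
    · ext (p | p | p | p) <;> simp [sagbiIdeal] <;> omega
    · simp only [degree_sagbi, sagbiExp, edgeExp, rowExp, colExp]; abel
    · simp only [degree_sagbi]
      have h1 := sagbi_mul_mem_productSpan (k := k) (I := edge l' j) (J := minors i l n n' hil hn)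
        (d := sagbiExp (edge i j) + sagbiExp (minors l l' n n' hl hn)) (by
          refine toSyn_lt_of_eq_add (Finsupp.single (xLeft i) 1 + Finsupp.single (yRight j) 1 +
            colExp a n n') (rowExp_lt hl) ?_ ?_ <;>
          · simp only [sagbiExp, edgeExp, rowExp, colExp]; abel)
      convert neg_mem h1 using 1
      simp only [sagbi]
      linear_combination colMinor a k n n' * hrow i l l' j
  · refine ⟨edge i n', minors l l' n j hl (hn.trans hjn), ?_, ?_, ?_, ?_⟩
    · ext (p | p | p | p) <;> simp [sagbiIdeal] <;> omega
    · ext (p | p | p | p) <;> simp [sagbiIdeal] <;> omega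
    · simp only [degree_sagbi, sagbiExp, edgeExp, rowExp, colExp]; abel
    · simp only [degree_sagbi]
      have h2 := sagbi_mul_mem_productSpan (k := k) (I := edge i n)
        (J := minors l l' n' j hl hjn)
        (d := sagbiExp (edge i j) + sagbiExp (minors l l' n n' hl hn)) (by
          refine toSyn_lt_of_eq_add (Finsupp.single (xLeft i) 1 + Finsupp.single (yRight j) 1 +
            rowExp b l l') (colExp_lt hn) ?_ ?_ <;>
          · simp only [sagbiExp, edgeExp, rowExp, colExp]; abel)
      convert neg_mem h2 using 1
      simp only [sagbi]
      linear_combination rowMinor b k l l' * hcol i j n n'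
  · refine straightens_of_subset ?_
    rintro (p | p | p | p) <;> simp [sagbiIdeal] <;> omega

theorem rowExp_add_rowExp (i i' l l' : Fin a) :
    rowExp b (max i l) (max i' l') + rowExp b (min i l) (min i' l') =
      rowExp b i i' + rowExp b l l' := by
  rcases le_total i l with h | h <;> rcases le_total i' l' with h' | h' <;>
    simp only [rowExp, max_eq_left, max_eq_right, min_eq_left, min_eq_right, h, h'] <;> abel

theorem colExp_add_colExp (j j' n n' : Fin b) :
    colExp a (min j n) (min j' n') + colExp a (max j n) (max j' n') =
      colExp a j j' + colExp a n n' := by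
  rcases le_total j n with h | h <;> rcases le_total j' n' with h' | h' <;>
    simp only [colExp, max_eq_left, max_eq_right, min_eq_left, min_eq_right, h, h'] <;> abel

variable (b k) in
/-- The Plücker relation, which is needed only if one of the two pairs lies strictly inside the
other; otherwise the two products agree. -/
theorem rowMinor_mul_rowMinor {i i' l l' : Fin a} (hi : i < i') (hl : l < l') :
    ∃ E : MvPolynomial (EdgeVar (Fin a ⊕ₗ Fin b)) k,
      rowMinor b k i i' * rowMinor b k l l' =
        rowMinor b k (max i l) (max i' l') * rowMinor b k (min i l) (min i' l') - E ∧
      (E = 0 ∨ ∃ p p' q q', p < p' ∧ q < q' ∧ E = rowMinor b k p p' * rowMinor b k q q' ∧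
        (rowExp b p p' + rowExp b q q') ≺[MonomialOrder.degLex]
          (rowExp b i i' + rowExp b l l')) := by
  rcases lt_trichotomy i l with h | rfl | h
  · rcases le_or_gt i' l' with h' | h'
    · exact ⟨0, by simp [h.le, h', mul_comm], Or.inl rfl⟩
    · refine ⟨rowMinor b k i l * rowMinor b k l' i', ?_, Or.inr ⟨_, _, _, _, h, h', rfl, ?_⟩⟩
      · simp only [h.le, h'.le, max_eq_left, max_eq_right, min_eq_left, min_eq_right, rowMinor]
        ring
      · refine toSyn_lt_of_eq_add (rowExp b i i') (rowExp_lt hl) ?_ ?_ <;> simp only [rowExp]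
        abel
  · refine ⟨0, ?_, Or.inl rfl⟩
    rcases le_total i' l' with h' | h' <;> simp [h', mul_comm]
  · rcases le_or_gt l' i' with h' | h'
    · exact ⟨0, by simp [h.le, h'], Or.inl rfl⟩
    · refine ⟨rowMinor b k l i * rowMinor b k i' l', ?_, Or.inr ⟨_, _, _, _, h, h', rfl, ?_⟩⟩
      · simp only [h.le, h'.le, max_eq_left, max_eq_right, min_eq_left, min_eq_right, rowMinor]
        ring
      · refine toSyn_lt_of_eq_add (rowExp b l l') (rowExp_lt hi) ?_ ?_ <;>
          simp only [rowExp] <;> abel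

variable (a k) in
theorem colMinor_mul_colMinor {j j' n n' : Fin b} (hj : j < j') (hn : n < n') :
    ∃ E : MvPolynomial (EdgeVar (Fin a ⊕ₗ Fin b)) k,
      colMinor a k j j' * colMinor a k n n' =
        colMinor a k (min j n) (min j' n') * colMinor a k (max j n) (max j' n') - E ∧
      (E = 0 ∨ ∃ p p' q q', p < p' ∧ q < q' ∧ E = colMinor a k p p' * colMinor a k q q' ∧
        (colExp a p p' + colExp a q q') ≺[MonomialOrder.degLex]
          (colExp a j j' + colExp a n n')) := by
  rcases lt_trichotomy j n with h | rfl | h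
  · rcases le_or_gt j' n' with h' | h'
    · exact ⟨0, by simp [h.le, h'], Or.inl rfl⟩
    · refine ⟨colMinor a k j n * colMinor a k n' j', ?_, Or.inr ⟨_, _, _, _, h, h', rfl, ?_⟩⟩
      · simp only [h.le, h'.le, max_eq_left, max_eq_right, min_eq_left, min_eq_right, colMinor]
        ring
      · refine toSyn_lt_of_eq_add (colExp a j j') (colExp_lt hn) ?_ ?_ <;> simp only [colExp]
        abel
  · refine ⟨0, ?_, Or.inl rfl⟩
    rcases le_total j' n' with h' | h' <;> simp [h', mul_comm]
  · rcases le_or_gt n' j' with h' | h'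
    · exact ⟨0, by simp [h.le, h', mul_comm], Or.inl rfl⟩
    · refine ⟨colMinor a k n j * colMinor a k j' n', ?_, Or.inr ⟨_, _, _, _, h, h', rfl, ?_⟩⟩
      · simp only [h.le, h'.le, max_eq_left, max_eq_right, min_eq_left, min_eq_right, colMinor]
        ring
      · refine toSyn_lt_of_eq_add (colExp a n n') (colExp_lt hj) ?_ ?_ <;>
          simp only [colExp] <;> abel

variable (k) in
theorem straightens_minors_minors (i i' l l' : Fin a) (j j' n n' : Fin b) (hi : i < i')
    (hl : l < l') (hj : j < j') (hn : n < n') :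
    Straightens MonomialOrder.degLex (sagbi k) (fun I ↦ {p | sagbiIdeal I p})
      (minors i i' j j' hi hj) (minors l l' n n' hl hn) := by
  have hmax : max i l < max i' l' := max_lt_max hi hl
  have hmin : min i l < min i' l' := min_lt_min hi hl
  have hmax' : max j n < max j' n' := max_lt_max hj hn
  have hmin' : min j n < min j' n' := min_lt_min hj hn
  refine ⟨minors _ _ _ _ hmax hmin', minors _ _ _ _ hmin hmax', ?_, ?_, ?_, ?_⟩
  · ext (p | p | p | p) <;> simp [sagbiIdeal] <;> omega
  · ext (p | p | p | p) <;> simp [sagbiIdeal] <;> omega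
  · simp only [degree_sagbi, sagbiExp]
    rw [add_add_add_comm, ← rowExp_add_rowExp, ← colExp_add_colExp, add_add_add_comm]
  simp only [degree_sagbi]
  have hmem : ∀ p p' q q' (hp : p < p') (hq : q < q') r r' s s' (hr : r < r') (hs : s < s'),
      (rowExp b p p' + rowExp b q q' + (colExp a r r' + colExp a s s')) ≺[MonomialOrder.degLex]
        (rowExp b i i' + rowExp b l l' + (colExp a j j' + colExp a n n')) →
      (rowMinor b k p p' * rowMinor b k q q') * (colMinor a k r r' * colMinor a k s s') ∈
        productSpan MonomialOrder.degLex (sagbi k) (· < MonomialOrder.degLex.toSyn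
          (sagbiExp (minors i i' j j' hi hj) + sagbiExp (minors l l' n n' hl hn))) := by
    intro p p' q q' hp hq r r' s s' hr hs h
    have := sagbi_mul_mem_productSpan (k := k) (I := minors p p' r r' hp hr)
      (J := minors q q' s s' hq hs)
      (d := sagbiExp (minors i i' j j' hi hj) + sagbiExp (minors l l' n n' hl hn)) (by
        simp only [sagbiExp]
        rwa [add_add_add_comm, add_add_add_comm (rowExp b i i')])
    convert this using 1
    simp only [sagbi]; ring
  obtain ⟨E, hE, hE'⟩ := rowMinor_mul_rowMinor b k hi hl
  obtain ⟨F, hF, hF'⟩ := colMinor_mul_colMinor a k hj hn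
  -- The rows are straightened first, with the column factors as they are; the columns follow in
  -- the leading term.
  have h1 : E * (colMinor a k j j' * colMinor a k n n') ∈
      productSpan MonomialOrder.degLex (sagbi k) (· < MonomialOrder.degLex.toSyn
        (sagbiExp (minors i i' j j' hi hj) + sagbiExp (minors l l' n n' hl hn))) := by
    rcases hE' with rfl | ⟨p, p', q, q', hp, hq, rfl, hlt⟩
    · simp
    · refine hmem p p' q q' hp hq j j' n n' hj hn ?_
      rw [map_add, map_add _ (rowExp b i i' + rowExp b l l')]
      exact add_lt_add_left hlt _
  have h2 : rowMinor b k (max i l) (max i' l') * rowMinor b k (min i l) (min i' l') * F ∈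
      productSpan MonomialOrder.degLex (sagbi k) (· < MonomialOrder.degLex.toSyn
        (sagbiExp (minors i i' j j' hi hj) + sagbiExp (minors l l' n n' hl hn))) := by
    rcases hF' with rfl | ⟨r, r', s, s', hr, hs, rfl, hlt⟩
    · simp
    · refine hmem _ _ _ _ hmax hmin r r' s s' hr hs ?_
      rw [rowExp_add_rowExp, map_add, map_add _ (rowExp b i i' + rowExp b l l')]
      exact add_lt_add_right hlt _
  convert neg_mem (add_mem h1 h2) using 1
  simp only [sagbi]
  linear_combination colMinor a k j j' * colMinor a k n n' * hE +
    rowMinor b k (max i l) (max i' l') * rowMinor b k (min i l) (min i' l') * hF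

variable (a b k) in
theorem hasStraightening_sagbi :
    HasStraightening MonomialOrder.degLex (sagbi (a := a) (b := b) k)
      (fun I ↦ {p | sagbiIdeal I p}) := by
  rintro (⟨i, j⟩ | ⟨i, i', j, j', hi, hj⟩) (⟨l, n⟩ | ⟨l, l', n, n', hl, hn⟩)
  · exact straightens_edge_edge k i l j n
  · exact straightens_edge_minors k i l l' j n n' hl hn
  · exact (straightens_edge_minors k l i i' n j j' hi hj).symm
  · exact straightens_minors_minors k i i' l l' j j' n n' hi hl hj hn

end Relations

/-! ### Poset ideals of `Π_{a,b}` -/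

section Poset

open SagbiIndex BipartitePoset

variable {a b : ℕ}

theorem sagbiIdeal_of_edge (I : SagbiIndex a b) {p q : BipartitePoset a b}
    (h : BipartitePoset.Edge p q) (hq : sagbiIdeal I q) : sagbiIdeal I p := by
  cases I <;> cases h <;> simp only [sagbiIdeal] at hq ⊢ <;> grind

/-- The poset ideal attached to a member of the SAGBI basis. -/
def sagbiLowerSet (I : SagbiIndex a b) : LowerSet (BipartitePoset a b) where
  carrier := {p | sagbiIdeal I p}
  lower' p q hqp hp := by
    induction (hqp : Relation.ReflTransGen BipartitePoset.Edge q p) using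
      Relation.ReflTransGen.head_induction_on with
    | refl => exact hp
    | head h _ ih => exact sagbiIdeal_of_edge I h ih

@[simp]
theorem mem_sagbiLowerSet {I : SagbiIndex a b} {p : BipartitePoset a b} :
    p ∈ sagbiLowerSet I ↔ sagbiIdeal I p := Iff.rfl

theorem sagbiIdeal_injective (hb : 2 ≤ b) :
    Function.Injective fun I : SagbiIndex a b ↦ {p | sagbiIdeal I p} := by
  intro I J h
  have h' (p : BipartitePoset a b) : sagbiIdeal I p ↔ sagbiIdeal J p := Set.ext_iff.1 h p
  have hx (i i' : Fin a)
      (H : ∀ l : Set.Ico 1 a, (i : ℕ) + 1 ≤ l ↔ (i' : ℕ) + 1 ≤ l) : i = i' := by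
    by_contra hne
    rcases lt_or_gt_of_ne hne with hlt | hlt
    · have := H ⟨i', by simp; omega⟩
      simp at this; omega
    · have := H ⟨i, by simp; omega⟩
      simp at this; omega
  have hy (j j' : Fin b)
      (H : ∀ l : Set.Icc 2 b, (l : ℕ) ≤ j + 1 ↔ (l : ℕ) ≤ j' + 1) : j = j' := by
    by_contra hne
    rcases lt_or_gt_of_ne hne with hlt | hlt
    · have := H ⟨j' + 1, by simp; omega⟩
      simp at this; omega
    · have := H ⟨j + 1, by simp; omega⟩
      simp at this; omega
  rcases I with ⟨i, j⟩ | ⟨i, i', j, j', hi, hj⟩ <;>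
    rcases J with ⟨l, n⟩ | ⟨l, l', n, n', hl, hn⟩
  · rw [hx i l fun p ↦ h' (e p), hy j n fun p ↦ h' (f p)]
  · exact absurd ((h' (f' ⟨1, by simp; omega⟩)).2 (by simp [sagbiIdeal])) (by simp [sagbiIdeal])
  · exact absurd ((h' (f' ⟨1, by simp; omega⟩)).1 (by simp [sagbiIdeal])) (by simp [sagbiIdeal])
  · obtain rfl := hx i l fun p ↦ h' (e p)
    obtain rfl := hy j' n' fun p ↦ h' (f p)
    obtain rfl : i' = l' := by
      by_contra hne
      rcases lt_or_gt_of_ne hne with hlt | hlt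
      · have := h' (e' ⟨l', by simp; omega⟩)
        simp [sagbiIdeal] at this; omega
      · have := h' (e' ⟨i', by simp; omega⟩)
        simp [sagbiIdeal] at this; omega
    obtain rfl : j = n := by
      by_contra hne
      rcases lt_or_gt_of_ne hne with hlt | hlt
      · have := h' (f' ⟨n + 1, by simp; omega⟩)
        simp [sagbiIdeal] at this; omega
      · have := h' (f' ⟨j + 1, by simp; omega⟩)
        simp [sagbiIdeal] at this; omega
    rfl

/-- An upward closed predicate on `{1, …, n - 1}` is given by a threshold. -/
theorem exists_threshold {n : ℕ} (hn : 1 ≤ n) (p : ℕ → Prop)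
    (hp : ∀ l, 1 ≤ l → l + 1 < n → p l → p (l + 1)) :
    ∃ i < n, ∀ l, 1 ≤ l → l < n → (p l ↔ i + 1 ≤ l) := by
  classical
  have hex : ∃ l, 1 ≤ l ∧ (p l ∨ l = n) := ⟨n, hn, Or.inr rfl⟩
  have hle : Nat.find hex ≤ n := Nat.find_min' hex ⟨hn, Or.inr rfl⟩
  have h1 : 1 ≤ Nat.find hex := (Nat.find_spec hex).1
  refine ⟨Nat.find hex - 1, by omega, fun l hl hln ↦ ⟨fun h ↦ ?_, fun h ↦ ?_⟩⟩
  · have := Nat.find_min' hex ⟨hl, Or.inl h⟩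
    omega
  · have hp0 : p (Nat.find hex) := (Nat.find_spec hex).2.resolve_right (by omega)
    have : Nat.find hex ≤ l := by omega
    revert hln
    induction l, this using Nat.le_induction with
    | base => exact fun _ ↦ hp0
    | succ l hle ih => exact fun hln ↦ hp l (by omega) hln (ih (by omega) (by omega) (by omega))

theorem sagbiLowerSet_surjective (ha : 2 ≤ a) (hab : a ≤ b) :
    Function.Surjective (sagbiLowerSet (a := a) (b := b)) := by
  intro I
  have hI {p q : BipartitePoset a b} (h : BipartitePoset.Edge p q) (hq : q ∈ I) : p ∈ I :=
    I.lower (Relation.ReflTransGen.single h) hq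
  obtain ⟨i, hia, hi⟩ := exists_threshold (n := a) (by omega)
    (fun l ↦ ∃ h : l ∈ Set.Ico 1 a, e ⟨l, h⟩ ∈ I)
    (fun l h1 h2 ⟨h, hl⟩ ↦ ⟨by simp; omega, hI (.e_e _ _ rfl) hl⟩)
  obtain ⟨j, hjb, hj⟩ := exists_threshold (n := b) (by omega)
    (fun l ↦ ¬ ∃ h : l + 1 ∈ Set.Icc 2 b, f ⟨l + 1, h⟩ ∈ I)
    (fun l h1 h2 h ⟨h3, hl⟩ ↦ h ⟨by simp; omega, hI (.f_f _ _ rfl) hl⟩)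
  have he (l : Set.Ico 1 a) : e l ∈ I ↔ i + 1 ≤ l := by
    rw [← hi l l.2.1 l.2.2]
    exact ⟨fun h ↦ ⟨l.2, h⟩, fun ⟨_, h⟩ ↦ h⟩
  have hf (l : Set.Icc 2 b) : f l ∈ I ↔ l ≤ j + 1 := by
    obtain ⟨l, hl, hl'⟩ := l
    obtain ⟨l, rfl⟩ : ∃ l', l = l' + 1 := ⟨l - 1, by omega⟩
    have := hj l (by omega) (by omega)
    rw [not_iff_comm] at this
    refine Iff.trans ⟨fun h ↦ ⟨⟨hl, hl'⟩, h⟩, fun ⟨_, h⟩ ↦ h⟩ (this.symm.trans ?_)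
    simp
  by_cases h1 : f' ⟨1, by simp; omega⟩ ∈ I
  · obtain ⟨i', hi'a, hi'⟩ := exists_threshold (n := a - 1) (by omega)
      (fun l ↦ ∃ h : l + 1 ∈ Set.Ico 2 a, e' ⟨l + 1, h⟩ ∈ I)
      (fun l h1 h2 ⟨h, hl⟩ ↦ ⟨by simp; omega, hI (.e'_e' _ _ rfl) hl⟩)
    obtain ⟨j', hj'b, hj'⟩ := exists_threshold (n := b) (by omega)
      (fun l ↦ ¬ ∃ h : l ∈ Set.Ico 1 b, f' ⟨l, h⟩ ∈ I)
      (fun l h1 h2 h ⟨h3, hl⟩ ↦ h ⟨by simp; omega, hI (.f'_f' _ _ rfl) hl⟩)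
    have he' (l : Set.Ico 2 a) : e' l ∈ I ↔ i' + 2 ≤ l := by
      obtain ⟨l, hl, hl'⟩ := l
      obtain ⟨l, rfl⟩ : ∃ l', l = l' + 1 := ⟨l - 1, by omega⟩
      have := hi' l (by omega) (by omega)
      refine Iff.trans ⟨fun h ↦ ⟨⟨hl, hl'⟩, h⟩, fun ⟨_, h⟩ ↦ h⟩ (this.trans ?_)
      simp
    have hf' (l : Set.Ico 1 b) : f' l ∈ I ↔ l ≤ j' := by
      have := hj' l l.2.1 l.2.2
      rw [not_iff_comm] at this
      refine Iff.trans ⟨fun h ↦ ⟨l.2, h⟩, fun ⟨_, h⟩ ↦ h⟩ (this.symm.trans ?_)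
      simp
    have hj1 : 1 ≤ j' := (hf' _).1 h1
    have hii : i < i' + 1 := by
      by_cases h : i' + 2 < a
      · have := (he' ⟨i' + 2, by simp; omega⟩).2 le_rfl
        have := (he ⟨i' + 1, by simp; omega⟩).1 (hI (.e_e' _ _ rfl) this)
        simp at this; omega
      · have := (he ⟨a - 1, by simp; omega⟩).1 (hI (.e_f' _ _ (by simp; omega) rfl) h1)
        simp at this; omega
    have hjj : j' - 1 < j := by
      have := (hf' ⟨j', by simp; omega⟩).2 le_rfl
      have := (hf ⟨j' + 1, by simp; omega⟩).1 (hI (.f_f' _ _ rfl) this)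
      simp at this; omega
    refine ⟨minors ⟨i, hia⟩ ⟨i' + 1, by omega⟩ ⟨j' - 1, by omega⟩ ⟨j, hjb⟩ hii hjj, ?_⟩
    ext (p | p | p | p)
    · exact (he p).symm
    · exact (he' p).symm
    · refine Iff.trans ?_ (hf' p).symm
      change (p : ℕ) ≤ j' - 1 + 1 ↔ _
      omega
    · exact (hf p).symm
  · have h0 (l : Set.Ico 1 b) : f' l ∉ I := by
      obtain ⟨l, hl, hl'⟩ := l
      induction l, hl using Nat.le_induction with
      | base => exact h1
      | succ l hl ih => exact fun h ↦ ih (by omega) (hI (.f'_f' _ _ rfl) h)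
    have h0' (l : Set.Ico 2 a) : e' l ∉ I := by
      -- Descending induction from `e'_{a-1}`, which lies above `f'_1`.
      obtain ⟨l, hl, hl'⟩ := l
      obtain ⟨c, hc⟩ : ∃ c, l + 1 + c = a := ⟨a - (l + 1), by omega⟩
      induction c generalizing l with
      | zero => exact fun h ↦ h1 (hI (.f'_e' _ _ rfl hc) h)
      | succ c ih =>
        exact fun h ↦ ih (l + 1) (by omega) (by omega) (by omega) (hI (.e'_e' _ _ rfl) h)
    refine ⟨edge ⟨i, hia⟩ ⟨j, hjb⟩, ?_⟩
    ext (p | p | p | p)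
    · exact (he p).symm
    · exact iff_of_false id (h0' p)
    · exact iff_of_false id (h0 p)
    · exact (hf p).symm

end Poset

/-! ### The isomorphism with the Hibi ring -/

section Hibi

open SagbiIndex BipartitePoset

variable {a b : ℕ}

section Sums

variable {n : ℕ}

/-- The sum of the first `l` values of `u`. -/
def initialSum (u : Fin n → ℕ) (l : ℕ) : ℕ :=
  ∑ i ∈ Finset.univ.filter (fun i : Fin n ↦ (i : ℕ) + 1 ≤ l), u i

/-- The sum of all values of `u` from the `l`-th one on, where the count starts at `1`. -/
def finalSum (u : Fin n → ℕ) (l : ℕ) : ℕ :=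
  ∑ i ∈ Finset.univ.filter (fun i : Fin n ↦ l ≤ (i : ℕ) + 1), u i

theorem initialSum_add (u v : Fin n → ℕ) (l : ℕ) :
    initialSum (fun i ↦ u i + v i) l = initialSum u l + initialSum v l :=
  Finset.sum_add_distrib

theorem finalSum_add (u v : Fin n → ℕ) (l : ℕ) :
    finalSum (fun i ↦ u i + v i) l = finalSum u l + finalSum v l :=
  Finset.sum_add_distrib

theorem initialSum_self (u : Fin n → ℕ) : initialSum u n = ∑ i, u i := by
  rw [initialSum, Finset.filter_true_of_mem fun i _ ↦ i.2]

theorem finalSum_one (u : Fin n → ℕ) : finalSum u 1 = ∑ i, u i := by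
  simp [finalSum]

theorem initialSum_succ (u : Fin n → ℕ) (i : Fin n) :
    initialSum u (i + 1) = u i + initialSum u i := by
  rw [initialSum, initialSum, ← Finset.sum_insert (by simp)]
  congr 1
  ext i'
  simp [Fin.ext_iff]
  omega

theorem finalSum_eq_add (u : Fin n → ℕ) (i : Fin n) :
    finalSum u (i + 1) = u i + finalSum u (i + 2) := by
  rw [finalSum, finalSum, ← Finset.sum_insert (by simp)]
  congr 1
  ext i'
  simp [Fin.ext_iff]
  omega

theorem eq_of_initialSum_eq {u v : Fin n → ℕ}
    (h : ∀ l, 1 ≤ l → l ≤ n → initialSum u l = initialSum v l) : u = v := by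
  funext i
  have h0 : initialSum u i = initialSum v i := by
    rcases Nat.eq_zero_or_pos (i : ℕ) with hi | hi
    · simp [initialSum, hi]
    · exact h i hi i.2.le
  have h1 := h (i + 1) (by omega) i.2
  rw [initialSum_succ, initialSum_succ, h0] at h1
  omega

theorem eq_of_finalSum_eq {u v : Fin n → ℕ}
    (h : ∀ l, 1 ≤ l → l ≤ n → finalSum u l = finalSum v l) : u = v := by
  funext i
  have h0 : finalSum u (i + 2) = finalSum v (i + 2) := by
    rcases Nat.lt_or_ge (i + 1) n with hi | hi
    · exact h (i + 2) (by omega) hi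
    · rw [finalSum, finalSum, Finset.filter_false_of_mem fun i' _ ↦ by omega]
      simp
  have h1 := h (i + 1) (by omega) i.2
  rw [finalSum_eq_add, finalSum_eq_add, h0] at h1
  omega

end Sums

/-- The map of exponents under which the leading monomials of the SAGBI basis correspond to the
generators of the Hibi ring: it sends `x_i` to `t ∏ e_l` over `l ≥ i`, `y'_i` to `∏ e'_l` over
`l ≥ i`, `x'_j` to `∏ f'_l` over `l ≤ j` and `y_j` to `∏ f_l` over `l ≤ j`. -/
noncomputable def hibiExp (a b : ℕ) :
    (EdgeVar (Fin a ⊕ₗ Fin b) →₀ ℕ) →+ (Option (BipartitePoset a b) →₀ ℕ) where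
  toFun d := Finsupp.equivFunOnFinite.symm fun
    | none => ∑ i, d (xLeft i)
    | some (e l) => initialSum (fun i ↦ d (xLeft i)) l
    | some (e' l) => initialSum (fun i ↦ d (yLeft i)) l
    | some (f' l) => finalSum (fun j ↦ d (xRight j)) l
    | some (f l) => finalSum (fun j ↦ d (yRight j)) l
  map_zero' := by ext (_ | _ | _ | _ | _) <;> simp [initialSum, finalSum]
  map_add' d d' := by
    ext (_ | _ | _ | _ | _) <;> simp [initialSum_add, finalSum_add, Finset.sum_add_distrib]

theorem hibiExp_none (d : EdgeVar (Fin a ⊕ₗ Fin b) →₀ ℕ) :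
    hibiExp a b d none = ∑ i, d (xLeft i) := rfl

theorem hibiExp_e (d : EdgeVar (Fin a ⊕ₗ Fin b) →₀ ℕ) (l : Set.Ico 1 a) :
    hibiExp a b d (some (e l)) = initialSum (fun i ↦ d (xLeft i)) l := rfl

theorem hibiExp_e' (d : EdgeVar (Fin a ⊕ₗ Fin b) →₀ ℕ) (l : Set.Ico 2 a) :
    hibiExp a b d (some (e' l)) = initialSum (fun i ↦ d (yLeft i)) l := rfl

theorem hibiExp_f' (d : EdgeVar (Fin a ⊕ₗ Fin b) →₀ ℕ) (l : Set.Ico 1 b) :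
    hibiExp a b d (some (f' l)) = finalSum (fun j ↦ d (xRight j)) l := rfl

theorem hibiExp_f (d : EdgeVar (Fin a ⊕ₗ Fin b) →₀ ℕ) (l : Set.Icc 2 b) :
    hibiExp a b d (some (f l)) = finalSum (fun j ↦ d (yRight j)) l := rfl

section Apply

@[simp]
theorem sagbiExp_edge_xLeft (i l : Fin a) (j : Fin b) :
    sagbiExp (edge i j) (xLeft l) = if i = l then 1 else 0 := by
  simp [sagbiExp, edgeExp, Finsupp.single_apply]

@[simp]
theorem sagbiExp_edge_yLeft (i l : Fin a) (j : Fin b) :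
    sagbiExp (edge i j) (yLeft l) = 0 := by
  simp [sagbiExp, edgeExp]

@[simp]
theorem sagbiExp_edge_xRight (i : Fin a) (j l : Fin b) :
    sagbiExp (edge i j) (xRight l) = 0 := by
  simp [sagbiExp, edgeExp]

@[simp]
theorem sagbiExp_edge_yRight (i : Fin a) (j l : Fin b) :
    sagbiExp (edge i j) (yRight l) = if j = l then 1 else 0 := by
  simp [sagbiExp, edgeExp, Finsupp.single_apply]

variable (i i' : Fin a) (j j' : Fin b) (hi : i < i') (hj : j < j')

@[simp]
theorem sagbiExp_minors_xLeft (l : Fin a) :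
    sagbiExp (minors i i' j j' hi hj) (xLeft l) = if i = l then 1 else 0 := by
  simp [sagbiExp, rowExp, colExp, Finsupp.single_apply]

@[simp]
theorem sagbiExp_minors_yLeft (l : Fin a) :
    sagbiExp (minors i i' j j' hi hj) (yLeft l) = if i' = l then 1 else 0 := by
  simp [sagbiExp, rowExp, colExp, Finsupp.single_apply]

@[simp]
theorem sagbiExp_minors_xRight (l : Fin b) :
    sagbiExp (minors i i' j j' hi hj) (xRight l) = if j = l then 1 else 0 := by
  simp [sagbiExp, rowExp, colExp, Finsupp.single_apply]

@[simp]
theorem sagbiExp_minors_yRight (l : Fin b) :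
    sagbiExp (minors i i' j j' hi hj) (yRight l) = if j' = l then 1 else 0 := by
  simp [sagbiExp, rowExp, colExp, Finsupp.single_apply]

end Apply

theorem hibiExp_sagbiExp_none (I : SagbiIndex a b) : hibiExp a b (sagbiExp I) none = 1 := by
  rw [hibiExp_none]
  cases I <;> simp

theorem hibiExp_sagbiExp_some (I : SagbiIndex a b) (p : BipartitePoset a b)
    [Decidable (sagbiIdeal I p)] :
    hibiExp a b (sagbiExp I) (some p) = if sagbiIdeal I p then 1 else 0 := by
  cases I <;> cases p <;>
    simp [hibiExp_e, hibiExp_e', hibiExp_f', hibiExp_f, sagbiIdeal, initialSum, finalSum] <;>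
    congr

variable (k : Type*) [Field k]

/-- The leading monomial of a product of members of the SAGBI basis determines the number of
factors and the intersection of their poset ideals. -/
theorem card_eq_and_inter_eq_of_multisetDegree_eq (s t : Multiset (SagbiIndex a b))
    (h : multisetDegree MonomialOrder.degLex (sagbi k) s =
      multisetDegree MonomialOrder.degLex (sagbi k) t) :
    s.card = t.card ∧
      {p | ∀ K ∈ s, p ∈ {p | sagbiIdeal K p}} = {p | ∀ K ∈ t, p ∈ {p | sagbiIdeal K p}} := by
  classical
  have hnone (s : Multiset (SagbiIndex a b)) :
      hibiExp a b (multisetDegree MonomialOrder.degLex (sagbi k) s) none = s.card := by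
    induction s using Multiset.induction_on with
    | empty => simp
    | cons I s ih =>
      rw [multisetDegree_cons, map_add, Finsupp.add_apply, ih, degree_sagbi,
        hibiExp_sagbiExp_none, Multiset.card_cons, add_comm]
  have hsome (s : Multiset (SagbiIndex a b)) (p : BipartitePoset a b) :
      hibiExp a b (multisetDegree MonomialOrder.degLex (sagbi k) s) (some p) =
        s.countP (sagbiIdeal · p) := by
    induction s using Multiset.induction_on with
    | empty => simp
    | cons I s ih =>
      rw [multisetDegree_cons, map_add, Finsupp.add_apply, ih, degree_sagbi,
        hibiExp_sagbiExp_some, Multiset.countP_cons, add_comm]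
  have hcard : s.card = t.card := by rw [← hnone, ← hnone, h]
  refine ⟨hcard, Set.ext fun p ↦ ?_⟩
  have hcount : s.countP (sagbiIdeal · p) = t.countP (sagbiIdeal · p) := by
    rw [← hsome, ← hsome, h]
  change (∀ K ∈ s, sagbiIdeal K p) ↔ ∀ K ∈ t, sagbiIdeal K p
  rw [← Multiset.countP_eq_card, ← Multiset.countP_eq_card, hcount, hcard]

theorem monomial_hibiExp (I : SagbiIndex a b)
    [DecidablePred fun p : BipartitePoset a b ↦ p ∈ sagbiLowerSet I] :
    monomial (hibiExp a b (sagbiExp I)) (1 : k) =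
      X none * ∏ p with p ∈ sagbiLowerSet I, X (some p) := by
  classical
  have : hibiExp a b (sagbiExp I) = Finsupp.single none 1 +
      ∑ p with p ∈ sagbiLowerSet I, Finsupp.single (some p) 1 := by
    ext (_ | p)
    · simp [hibiExp_sagbiExp_none]
    · rw [hibiExp_sagbiExp_some, Finsupp.add_apply, Finsupp.finsetSum_apply]
      simp [Finsupp.single_apply]
  rw [this, monomial_add_one, monomial_sum_one]
  rfl

theorem hibiRing_eq_adjoin (ha : 2 ≤ a) (hab : a ≤ b) :
    hibiRing k (BipartitePoset a b) = Algebra.adjoin k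
      (Set.range fun I : SagbiIndex a b ↦ monomial (hibiExp a b (sagbiExp I)) (1 : k)) := by
  rw [hibiRing, ← (sagbiLowerSet_surjective ha hab).range_comp]
  classical
  congr 2
  ext I : 1
  exact (monomial_hibiExp k I).symm

/-- A submonoid of exponents that contains the leading exponents of the SAGBI basis and on which
`hibiExp` is injective. -/
def balanced (a b : ℕ) : AddSubmonoid (EdgeVar (Fin a ⊕ₗ Fin b) →₀ ℕ) where
  carrier := {d | ∑ i, d (xLeft i) = ∑ j, d (yRight j) ∧ ∑ j, d (xRight j) = ∑ i, d (yLeft i) ∧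
    (∀ i : Fin a, (i : ℕ) = 0 → d (yLeft i) = 0) ∧
    ∀ j : Fin b, (j : ℕ) + 1 = b → d (xRight j) = 0}
  zero_mem' := by simp
  add_mem' {d d'} := by
    rintro ⟨h1, h2, h3, h4⟩ ⟨h1', h2', h3', h4'⟩
    refine ⟨?_, ?_, fun i hi ↦ ?_, fun j hj ↦ ?_⟩
    · simp only [Finsupp.add_apply, Finset.sum_add_distrib, h1, h1']
    · simp only [Finsupp.add_apply, Finset.sum_add_distrib, h2, h2']
    · rw [Finsupp.add_apply, h3 i hi, h3' i hi]
    · rw [Finsupp.add_apply, h4 j hj, h4' j hj]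

theorem sagbiExp_mem_balanced (I : SagbiIndex a b) : sagbiExp I ∈ balanced a b := by
  cases I with
  | edge i j => exact ⟨by simp, by simp, by simp, by simp⟩
  | minors i i' j j' hi hj =>
    refine ⟨by simp, by simp, fun l hl ↦ ?_, fun l hl ↦ ?_⟩
    · rw [sagbiExp_minors_yLeft, if_neg (by omega)]
    · rw [sagbiExp_minors_xRight, if_neg (by omega)]

theorem injOn_hibiExp (ha : 2 ≤ a) (hab : a ≤ b) : Set.InjOn (hibiExp a b) (balanced a b) := by
  rintro d ⟨h1, h2, h3, h4⟩ d' ⟨h1', h2', h3', h4'⟩ h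
  have H (o) : hibiExp a b d o = hibiExp a b d' o := by rw [h]
  have hx : (fun i ↦ d (xLeft i)) = fun i ↦ d' (xLeft i) := by
    refine eq_of_initialSum_eq fun l hl hla ↦ ?_
    rcases hla.lt_or_eq with hla | rfl
    · exact H (some (e ⟨l, hl, hla⟩))
    · rw [initialSum_self, initialSum_self]; exact H none
  have hy : (fun j ↦ d (yRight j)) = fun j ↦ d' (yRight j) := by
    refine eq_of_finalSum_eq fun l hl hlb ↦ ?_
    rcases hl.lt_or_eq with hl | rfl
    · exact H (some (f ⟨l, hl, hlb⟩))
    · rw [finalSum_one, finalSum_one, ← h1, ← h1']; exact H none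
  have hx' : (fun j ↦ d (xRight j)) = fun j ↦ d' (xRight j) := by
    refine eq_of_finalSum_eq fun l hl hlb ↦ ?_
    rcases hlb.lt_or_eq with hlb | rfl
    · exact H (some (f' ⟨l, hl, hlb⟩))
    · refine Finset.sum_congr rfl fun j hj ↦ ?_
      have : (j : ℕ) + 1 = l := le_antisymm j.2 (Finset.mem_filter.1 hj).2
      exact (h4 j this).trans (h4' j this).symm
  have hy' : (fun i ↦ d (yLeft i)) = fun i ↦ d' (yLeft i) := by
    refine eq_of_initialSum_eq fun l hl hla ↦ ?_
    rcases hla.lt_or_eq with hla | rfl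
    · rcases hl.lt_or_eq with hl | rfl
      · exact H (some (e' ⟨l, hl, hla⟩))
      · refine Finset.sum_congr rfl fun i hi ↦ ?_
        have : (i : ℕ) = 0 := by simpa using (Finset.mem_filter.1 hi).2
        exact (h3 i this).trans (h3' i this).symm
    · rw [initialSum_self, initialSum_self, ← h2, ← h2']
      exact congrArg (fun u : Fin b → ℕ ↦ ∑ j, u j) hx'
  ext v
  rcases v with (i | j) | (i | j)
  exacts [congrFun hx i, congrFun hx' j, congrFun hy' i, congrFun hy j]

theorem initialAlgebra_binomialEdgeRing (hb : 2 ≤ b) :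
    initialAlgebra (MonomialOrder.degLex (σ := EdgeVar (Fin a ⊕ₗ Fin b)))
        (binomialEdgeRing k (orderedCompleteBipartiteGraph a b)) =
      Algebra.adjoin k (Set.range fun I : SagbiIndex a b ↦ monomial (sagbiExp I) (1 : k)) := by
  rw [binomialEdgeRing_eq_adjoin_sagbi, (hasStraightening_sagbi a b k).initialAlgebra_eq
    sagbi_monic (sagbiIdeal_injective hb) (card_eq_and_inter_eq_of_multisetDegree_eq k)]
  simp only [degree_sagbi]

end Hibi

theorem theorem1p2 (k : Type*) [Field k] (a b : ℕ) (ha : 2 ≤ a) (hab : a ≤ b) :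
    Nonempty
      (initialAlgebra (MonomialOrder.degLex (σ := EdgeVar (Fin a ⊕ₗ Fin b)))
          (binomialEdgeRing k (orderedCompleteBipartiteGraph a b)) ≃ₐ[k]
        hibiRing k (BipartitePoset a b)) := by
  rw [initialAlgebra_binomialEdgeRing k (ha.trans hab), hibiRing_eq_adjoin k ha hab]
  exact nonempty_algEquiv_adjoin_monomial sagbiExp_mem_balanced _ (injOn_hibiExp ha hab)
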